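/- Let $A$ and $B$ be separable $C^*$-algebras (not necessarily unital). For right Hilbert $B$-modules $E,F$, let $\mathcal L(E,F)$ be the space of adjointable bounded operators $E\to F$ with the operator norm, $\mathcal L(E)=\mathcal L(E,E)$, and let $\mathcal K(F)\subseteq\mathcal L(F)$ be the closed linear span of the operators $z\mapsto y\langle x,z\rangle$ with $x,y\in F$. A representation of $A$ on $E$ is a (not necessarily unital) $*$-homomorphism $A\to\mathcal L(E)$. For representations $\pi:A\to\mathcal L(E)$ and $\sigma:A\to\mathcal L(F)$ write $\pi\sim\sigma$ if there is a sequence of unitaries $u_n\in\mathcal L(E,F)$ such that, for every $a\in A$, $\lim_{n\to\infty}\|\sigma(a)-u_n\pi(a)u_n^*\|=0$ and $\sigma(a)-u_n\pi(a)u_n^*\in\mathcal K(F)$ for all $n$. A representation $\pi:A\to\mathcal L(E)$ is absorbing if $\pi\oplus\sigma\sim\pi$ for every representation $\sigma$ of $A$ on a countably generated Hilbert $B$-module. Let $H_B$ be the standard Hilbert $B$-module, that is, the module of sequences $(b_n)_{n\in\mathbb N}$ in $B$ for which $\sum_n b_n^*b_n$ converges in norm, with $\langle b,c\rangle=\sum_n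 b_n^*c_n$. **Theorem.** If two representations $\psi,\varphi:A\to\mathcal L(H_B)$ are absorbing, then they are asymptotically unitarily equivalent: there is a norm-continuous map $u:[0,\infty)\to\mathcal L(H_B)$, $t\mapsto u_t$, with unitary values, such that for every $a\in A$ the function $t\mapsto\psi(a)-u_t\varphi(a)u_t^*$ belongs to $C_0([0,\infty))\otimes\mathcal K(H_B)=C_0([0,\infty),\mathcal K(H_B))$. -/

import Mathlib

open Filter Topology
open scoped NNReal ZeroAtInfty WithCStarModule

/-! Hilbert modules are Mathlib's `CStarModule`s over a C⋆-algebra `C`. In Mathlib a right action of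
`B` is an action of `Bᵐᵒᵖ`, and `CStarModule Bᵐᵒᵖ E` is exactly the structure of a *right* Hilbert
`B`-module: writing `x b` for `op b • x` and `⟨x, y⟩` for the `B`-valued inner product
`unop (inner Bᵐᵒᵖ x y)`, the axiom `inner_op_smul_right` reads `⟨x, y b⟩ = ⟨x, y⟩ b`. The definitions
below are written for a general `C`, and used with `C = Bᵐᵒᵖ`. -/

universe v

namespace HilbertModule

/-! ### Adjointable operators -/

section Adjointable

variable (C : Type*) [NonUnitalCStarAlgebra C] [PartialOrder C]
variable (E : Type*) [NormedAddCommGroup E] [NormedSpace ℂ E] [SMul C E] [CStarModule C E]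
variable (F : Type*) [NormedAddCommGroup F] [NormedSpace ℂ F] [SMul C F] [CStarModule C F]
variable (G : Type*) [NormedAddCommGroup G] [NormedSpace ℂ G] [SMul C G] [CStarModule C G]

/-- `𝓛(E, F)`: bounded operators `E → F` together with an adjoint `F → E` with respect to the
`C`-valued inner products (the adjoint is unique, see `Adjointable.ext`). -/
structure Adjointable where
  /-- the underlying bounded operator -/
  toCLM : E →L[ℂ] F
  /-- its adjoint -/
  adj : F →L[ℂ] E
  inner_toCLM : ∀ x y, inner C (toCLM x) y = inner C x (adj y)

namespace Adjointable

variable {C E F G}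

lemma eq_of_inner {x y : E} (h : ∀ z : E, inner C z x = inner C z y) : x = y := by
  have h0 : inner C (x - y) (x - y) = 0 := by
    rw [CStarModule.inner_sub_right, h, sub_self]
  exact sub_eq_zero.mp (CStarModule.inner_self.mp h0)

@[ext]
lemma ext {S T : Adjointable C E F} (h : S.toCLM = T.toCLM) : S = T := by
  obtain ⟨s, s', hs⟩ := S
  obtain ⟨t, t', ht⟩ := T
  obtain rfl : s = t := h
  congr
  ext y
  exact eq_of_inner (C := C) fun z => by rw [← hs, ← ht]

lemma toCLM_injective :
    Function.Injective (toCLM : Adjointable C E F → E →L[ℂ] F) := fun _ _ h => ext h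

lemma inner_adj (T : Adjointable C E F) (x : F) (y : E) :
    inner C (T.adj x) y = inner C x (T.toCLM y) := by
  rw [← CStarModule.star_inner, ← T.inner_toCLM, CStarModule.star_inner]

/-- The adjoint `T* ∈ 𝓛(F, E)` of `T ∈ 𝓛(E, F)`. -/
def adjoint (T : Adjointable C E F) : Adjointable C F E := ⟨T.adj, T.toCLM, T.inner_adj⟩

/-- The composition of adjointable operators. -/
def comp (T : Adjointable C F G) (S : Adjointable C E F) : Adjointable C E G :=
  ⟨T.toCLM.comp S.toCLM, S.adj.comp T.adj, fun x y => by
    simp [T.inner_toCLM, S.inner_toCLM]⟩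

variable (C E) in
/-- The identity operator. -/
def id : Adjointable C E E := ⟨.id ℂ E, .id ℂ E, fun _ _ => rfl⟩

/-- `U ∈ 𝓛(E, F)` is a unitary if `U* U = 1` and `U U* = 1`. -/
def IsUnitary (U : Adjointable C E F) : Prop :=
  U.adjoint.comp U = id C E ∧ U.comp U.adjoint = id C F

instance : Zero (Adjointable C E F) := ⟨⟨0, 0, fun _ _ => by simp⟩⟩
instance : Add (Adjointable C E F) :=
  ⟨fun S T => ⟨S.toCLM + T.toCLM, S.adj + T.adj, fun x y => by
    simp [S.inner_toCLM, T.inner_toCLM]⟩⟩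
instance : Neg (Adjointable C E F) :=
  ⟨fun T => ⟨-T.toCLM, -T.adj, fun x y => by simp [T.inner_toCLM]⟩⟩
instance : Sub (Adjointable C E F) :=
  ⟨fun S T => ⟨S.toCLM - T.toCLM, S.adj - T.adj, fun x y => by
    simp [S.inner_toCLM, T.inner_toCLM]⟩⟩
instance : SMul ℂ (Adjointable C E F) :=
  ⟨fun c T => ⟨c • T.toCLM, star c • T.adj, fun x y => by simp [T.inner_toCLM]⟩⟩

instance : AddCommGroup (Adjointable C E F) where
  add_assoc _ _ _ := ext (add_assoc _ _ _)
  zero_add _ := ext (zero_add _)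
  add_zero _ := ext (add_zero _)
  neg_add_cancel _ := ext (neg_add_cancel _)
  add_comm _ _ := ext (add_comm _ _)
  sub_eq_add_neg _ _ := ext (sub_eq_add_neg _ _)
  nsmul := nsmulRec
  zsmul := zsmulRec

instance : Module ℂ (Adjointable C E F) where
  one_smul _ := ext (one_smul _ _)
  mul_smul _ _ _ := ext (mul_smul _ _ _)
  smul_zero _ := ext (smul_zero _)
  smul_add _ _ _ := ext (smul_add _ _ _)
  add_smul _ _ _ := ext (add_smul _ _ _)
  zero_smul _ := ext (zero_smul _ _)

variable (C E F) in
/-- The inclusion of `𝓛(E, F)` in the bounded operators, as a linear map. -/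
def toCLMₗ : Adjointable C E F →ₗ[ℂ] E →L[ℂ] F where
  toFun := toCLM
  map_add' _ _ := rfl
  map_smul' _ _ := rfl

/-- `𝓛(E, F)` carries the operator norm. -/
noncomputable instance : NormedAddCommGroup (Adjointable C E F) :=
  NormedAddCommGroup.induced _ _ (toCLMₗ C E F) toCLM_injective

noncomputable instance : NormedSpace ℂ (Adjointable C E F) :=
  NormedSpace.induced ℂ _ _ (toCLMₗ C E F)

/-- The product of `𝓛(E)` is composition, and its unit is the identity. -/
instance : Ring (Adjointable C E E) where
  mul := comp
  one := id C E
  mul_assoc _ _ _ := ext rfl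
  one_mul _ := ext rfl
  mul_one _ := ext rfl
  zero_mul _ := ext (by exact zero_mul (M₀ := E →L[ℂ] E) _)
  mul_zero _ := ext (by exact mul_zero (M₀ := E →L[ℂ] E) _)
  left_distrib _ _ _ := ext (by exact mul_add (R := E →L[ℂ] E) _ _ _)
  right_distrib _ _ _ := ext (by exact add_mul (R := E →L[ℂ] E) _ _ _)
  zsmul := zsmulRec
  neg_add_cancel _ := neg_add_cancel _
  sub_eq_add_neg _ _ := sub_eq_add_neg _ _

/-- The involution of `𝓛(E)` is the adjoint. -/
instance : StarRing (Adjointable C E E) where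
  star := adjoint
  star_involutive _ := rfl
  star_mul _ _ := rfl
  star_add _ _ := rfl

end Adjointable

/-! ### Compact operators -/

variable {C E F}

lemma norm_op_smul_le (c : C) (y : F) : ‖c • y‖ ≤ ‖c‖ * ‖y‖ := by
  refine le_of_sq_le_sq ?_ (by positivity)
  rw [mul_pow, CStarModule.norm_sq_eq C (E := F), CStarModule.norm_sq_eq C (E := F), CStarModule.inner_op_smul_right,
    CStarModule.inner_op_smul_left]
  calc ‖c * (inner C y y * star c)‖ ≤ ‖c‖ * (‖inner C y y‖ * ‖star c‖) :=
        (norm_mul_le _ _).trans (by gcongr; exact norm_mul_le _ _)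
    _ = ‖c‖ ^ 2 * ‖inner C y y‖ := by rw [norm_star]; ring

variable [StarOrderedRing C]

variable (C) in
/-- The bounded operator `z ↦ y ⟨x, z⟩`. -/
def rankOneCLM (y : F) (x : E) : E →L[ℂ] F :=
  LinearMap.mkContinuous
    { toFun := fun z => inner C x z • y
      map_add' := fun z w => Adjointable.eq_of_inner (C := C) fun v => by
        simp [add_mul]
      map_smul' := fun c z => Adjointable.eq_of_inner (C := C) fun v => by
        simp [smul_mul_assoc] }
    (‖x‖ * ‖y‖) fun z => by
      refine (norm_op_smul_le _ _).trans ?_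
      rw [mul_right_comm]
      gcongr
      exact CStarModule.norm_inner_le E

/-- The rank one operator `θ_{y, x} : z ↦ y ⟨x, z⟩` in `𝓛(E, F)`, for `y ∈ F` and `x ∈ E`. -/
def rankOne (y : F) (x : E) : Adjointable C E F where
  toCLM := rankOneCLM C y x
  adj := rankOneCLM C x y
  inner_toCLM z w := by simp [rankOneCLM]

variable (C E F) in
/-- `𝓚(E, F)`: the closed linear span of the rank one operators in `𝓛(E, F)`. -/
noncomputable def compacts : Submodule ℂ (Adjointable C E F) :=
  (Submodule.span ℂ (Set.range fun p : F × E => rankOne (C := C) p.1 p.2)).topologicalClosure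

variable (C E) in
/-- `E` is countably generated: for some countable `S ⊆ E`, the linear combinations of the
elements `x c` with `x ∈ S` and `c ∈ C` are dense in `E`. -/
def CountablyGenerated : Prop :=
  ∃ S : Set E, S.Countable ∧
    (Submodule.span ℂ {y : E | ∃ x ∈ S, ∃ c : C, y = c • x}).topologicalClosure = ⊤

/-! ### Representations and their direct sums -/

/-- The direct sum `S ⊕ T` of two adjointable operators, on the Hilbert module `E ⊕ F`. -/
noncomputable def Adjointable.directSum (S : Adjointable C E E) (T : Adjointable C F F) :
    Adjointable C C⋆ᵐᵒᵈ(C, E × F) C⋆ᵐᵒᵈ(C, E × F) where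
  toCLM := (WithCStarModule.equivL ℂ).symm.toContinuousLinearMap ∘L
    (S.toCLM.prodMap T.toCLM) ∘L (WithCStarModule.equivL ℂ).toContinuousLinearMap
  adj := (WithCStarModule.equivL ℂ).symm.toContinuousLinearMap ∘L
    (S.adj.prodMap T.adj) ∘L (WithCStarModule.equivL ℂ).toContinuousLinearMap
  inner_toCLM x y :=
    congrArg₂ (· + ·) (S.inner_toCLM x.1 y.1) (T.inner_toCLM x.2 y.2)

variable (A : Type*) [NonUnitalCStarAlgebra A]

variable (C E) in
/-- A representation of `A` on `E`: a (not necessarily unital) `*`-homomorphism `A → 𝓛(E)`. -/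
abbrev StarRep := A →⋆ₙₐ[ℂ] Adjointable C E E

variable {A}

/-- The direct sum `π ⊕ σ : A → 𝓛(E ⊕ F)` of two representations. -/
noncomputable def StarRep.directSum (π : StarRep C E A) (σ : StarRep C F A) :
    StarRep C C⋆ᵐᵒᵈ(C, E × F) A where
  toFun a := (π a).directSum (σ a)
  map_smul' c a := by rw [map_smul, map_smul]; rfl
  map_zero' := by rw [map_zero, map_zero]; rfl
  map_add' a b := by rw [map_add, map_add]; rfl
  map_mul' a b := by rw [map_mul, map_mul]; rfl
  map_star' a := by rw [map_star, map_star]; rfl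

/-- The operator `σ(a) - U π(a) U*` in `𝓛(F)`, for `U ∈ 𝓛(E, F)`. -/
def conjDiff (π : StarRep C E A) (σ : StarRep C F A) (U : Adjointable C E F)
    (a : A) : Adjointable C F F :=
  σ a - (U.comp (π a)).comp U.adjoint

/-- Approximate unitary equivalence `π ∼ σ`. -/
def ApproxUnitarilyEquiv (π : StarRep C E A) (σ : StarRep C F A) : Prop :=
  ∃ u : ℕ → Adjointable C E F, (∀ n, (u n).IsUnitary) ∧ ∀ a : A,
    Tendsto (fun n => ‖conjDiff π σ (u n) a‖) atTop (𝓝 0) ∧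
    ∀ n, conjDiff π σ (u n) a ∈ compacts C F F

/-- Asymptotic unitary equivalence: there is a norm continuous path of unitaries
`u : [0, ∞) → 𝓛(E, F)` such that for every `a` the function `t ↦ σ(a) - u_t π(a) u_t*` belongs to
`C₀([0, ∞)) ⊗ 𝓚(F) = C₀([0, ∞), 𝓚(F))`. -/
def AsympUnitarilyEquiv (π : StarRep C E A) (σ : StarRep C F A) : Prop :=
  ∃ u : ℝ≥0 → Adjointable C E F, Continuous u ∧ (∀ t, (u t).IsUnitary) ∧ ∀ a : A,
    ∃ f : C₀(ℝ≥0, compacts C F F), ∀ t, (f t : Adjointable C F F) = conjDiff π σ (u t) a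

end Adjointable

/-- `π` is absorbing if `π ⊕ σ ∼ π` for every representation `σ` of `A` on a countably generated
Hilbert `C`-module `F`. (A countably generated module has at most as many elements as sequences in
`C`, so nothing is lost by taking `F` in the universe of `C`.) -/
def IsAbsorbing {A : Type*} [NonUnitalCStarAlgebra A]
    {C : Type v} [NonUnitalCStarAlgebra C] [PartialOrder C] [StarOrderedRing C]
    {E : Type*} [NormedAddCommGroup E] [NormedSpace ℂ E] [SMul C E] [CStarModule C E]
    (π : StarRep C E A) : Prop :=
  ∀ (F : Type v) [NormedAddCommGroup F] [NormedSpace ℂ F] [SMul C F] [CStarModule C F]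
    [CompleteSpace F], CountablyGenerated C F → ∀ σ : StarRep C F A,
    ApproxUnitarilyEquiv (π.directSum σ) π

/-! ### The standard Hilbert module -/

section HilbertSum

variable (C : Type*) [NonUnitalCStarAlgebra C] [PartialOrder C] [StarOrderedRing C]
variable (E : Type*) [NormedAddCommGroup E] [NormedSpace ℂ E] [SMul C E] [CStarModule C E]

variable {C E} in
lemma norm_sum_inner_le (s : Finset ℕ) (x y : ℕ → E) :
    ‖∑ n ∈ s, inner C (x n) (y n)‖ ≤
      √‖∑ n ∈ s, inner C (x n) (x n)‖ * √‖∑ n ∈ s, inner C (y n) (y n)‖ := by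
  have h := CStarModule.norm_inner_le (A := C) C⋆ᵐᵒᵈ(C, (s → E))
    (x := (WithCStarModule.equiv C (s → E)).symm fun i => x i)
    (y := (WithCStarModule.equiv C (s → E)).symm fun i => y i)
  simp only [WithCStarModule.pi_inner, WithCStarModule.pi_norm,
    WithCStarModule.equiv_symm_pi_apply] at h
  rwa [Finset.sum_coe_sort s fun n => inner C (x n) (y n),
    Finset.sum_coe_sort s fun n => inner C (x n) (x n),
    Finset.sum_coe_sort s fun n => inner C (y n) (y n)] at h

variable {C E} in
lemma summable_inner {x y : ℕ → E} (hx : Summable fun n => inner C (x n) (x n))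
    (hy : Summable fun n => inner C (y n) (y n)) : Summable fun n => inner C (x n) (y n) := by
  rw [summable_iff_vanishing_norm] at hx hy ⊢
  intro ε hε
  obtain ⟨s, hs⟩ := hx ε hε
  obtain ⟨t, ht⟩ := hy ε hε
  refine ⟨s ∪ t, fun r hr => (norm_sum_inner_le r x y).trans_lt ?_⟩
  rw [Finset.disjoint_union_right] at hr
  calc _ < √ε * √ε := by
        gcongr
        · exact hs r hr.1
        · exact ht r hr.2
    _ = ε := Real.mul_self_sqrt hε.le

/-- The Hilbert module `ℓ²(ℕ, E) = E ⊕ E ⊕ ⋯`: the sequences `(xₙ)` in `E` for which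
`∑ ⟨xₙ, xₙ⟩` converges in norm (for series of positive elements, unconditional convergence is the
same as convergence). -/
@[ext]
structure HilbertSum where
  /-- the underlying sequence -/
  val : ℕ → E
  summable_self : Summable fun n => inner C (val n) (val n)

namespace HilbertSum

variable {C E}

lemma summable (x y : HilbertSum C E) : Summable fun n => inner C (x.1 n) (y.1 n) :=
  summable_inner x.2 y.2

instance : Zero (HilbertSum C E) := ⟨⟨0, by simp⟩⟩
instance : Add (HilbertSum C E) :=
  ⟨fun x y => ⟨x.1 + y.1, by
    have h := (x.2.add (summable y x)).add ((summable x y).add y.2)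
    simpa [add_assoc] using h⟩⟩
instance : Neg (HilbertSum C E) := ⟨fun x => ⟨-x.1, by simpa using x.2⟩⟩
instance : Sub (HilbertSum C E) :=
  ⟨fun x y => ⟨x.1 - y.1, by
    have h := (x.2.sub (summable y x)).sub ((summable x y).sub y.2)
    simpa using h⟩⟩
instance : SMul ℂ (HilbertSum C E) :=
  ⟨fun c x => ⟨c • x.1, by
    have h := (x.2.const_smul c).const_smul (star c)
    simpa only [Pi.smul_apply, CStarModule.inner_smul_right_complex,
      CStarModule.inner_smul_left_complex, smul_comm c] using h⟩⟩
/-- `(xₙ) c = (xₙ c)`. -/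
instance : SMul C (HilbertSum C E) :=
  ⟨fun c x => ⟨fun n => c • x.1 n, by
    have h := (x.2.mul_right (star c)).mul_left c
    simpa using h⟩⟩

instance : AddCommGroup (HilbertSum C E) where
  add_assoc _ _ _ := HilbertSum.ext (add_assoc _ _ _)
  zero_add _ := HilbertSum.ext (zero_add _)
  add_zero _ := HilbertSum.ext (add_zero _)
  neg_add_cancel _ := HilbertSum.ext (neg_add_cancel _)
  add_comm _ _ := HilbertSum.ext (add_comm _ _)
  sub_eq_add_neg _ _ := HilbertSum.ext (sub_eq_add_neg _ _)
  nsmul := nsmulRec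
  zsmul := zsmulRec

instance : Module ℂ (HilbertSum C E) where
  one_smul _ := HilbertSum.ext (one_smul _ _)
  mul_smul _ _ _ := HilbertSum.ext (mul_smul _ _ _)
  smul_zero _ := HilbertSum.ext (smul_zero _)
  smul_add _ _ _ := HilbertSum.ext (smul_add _ _ _)
  add_smul _ _ _ := HilbertSum.ext (add_smul _ _ _)
  zero_smul _ := HilbertSum.ext (zero_smul _ _)

noncomputable instance : Norm (HilbertSum C E) where
  norm x := √‖∑' n, inner C (x.1 n) (x.1 n)‖

/-- `⟨x, y⟩ = ∑ ⟨xₙ, yₙ⟩`. -/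
noncomputable instance : CStarModule C (HilbertSum C E) where
  inner x y := ∑' n, inner C (x.1 n) (y.1 n)
  inner_add_right {x y z} := by
    rw [← (summable x y).tsum_add (summable x z)]
    exact tsum_congr fun n => CStarModule.inner_add_right
  inner_self_nonneg := tsum_nonneg fun _ => CStarModule.inner_self_nonneg
  inner_self {x} := by
    refine ⟨fun h => HilbertSum.ext (funext fun n => ?_), fun h => ?_⟩
    · refine CStarModule.inner_self.mp (le_antisymm ?_ (CStarModule.inner_self_nonneg (A := C)))
      exact ((summable x x).le_tsum n fun _ _ => CStarModule.inner_self_nonneg).trans_eq h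
    · subst h
      exact (tsum_congr fun n => CStarModule.inner_zero_right).trans tsum_zero
  inner_op_smul_right {c x y} := by
    rw [← (summable x y).tsum_mul_left c]
    exact tsum_congr fun n => CStarModule.inner_op_smul_right
  inner_smul_right_complex {c x y} := by
    rw [← (summable x y).tsum_const_smul c]
    exact tsum_congr fun n => CStarModule.inner_smul_right_complex
  star_inner x y := by
    rw [tsum_star]
    exact tsum_congr fun n => CStarModule.star_inner _ _
  norm_eq_sqrt_norm_inner_self x := rfl

noncomputable instance : NormedAddCommGroup (HilbertSum C E) :=
  NormedAddCommGroup.ofCore (CStarModule.normedSpaceCore C)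

noncomputable instance : NormedSpace ℂ (HilbertSum C E) :=
  NormedSpace.ofCore (CStarModule.normedSpaceCore C)

lemma norm_sum_le (s : Finset ℕ) (x : HilbertSum C E) :
    √‖∑ n ∈ s, inner C (x.1 n) (x.1 n)‖ ≤ ‖x‖ :=
  Real.sqrt_le_sqrt <| CStarAlgebra.norm_le_norm_of_nonneg_of_le
    (Finset.sum_nonneg fun _ _ => CStarModule.inner_self_nonneg)
    ((summable x x).sum_le_tsum s fun _ _ => CStarModule.inner_self_nonneg)

lemma norm_le_of_sum {x : HilbertSum C E} {r : ℝ}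
    (h : ∀ s : Finset ℕ, √‖∑ n ∈ s, inner C (x.1 n) (x.1 n)‖ ≤ r) : ‖x‖ ≤ r :=
  le_of_tendsto' ((continuous_norm.sqrt.tendsto _).comp (summable x x).hasSum) h

lemma sqrt_sum_add_le (s : Finset ℕ) (x y : ℕ → E) :
    √‖∑ n ∈ s, inner C (x n + y n) (x n + y n)‖ ≤
      √‖∑ n ∈ s, inner C (x n) (x n)‖ + √‖∑ n ∈ s, inner C (y n) (y n)‖ := by
  have h := norm_add_le ((WithCStarModule.equiv C (s → E)).symm fun i => x i)
    ((WithCStarModule.equiv C (s → E)).symm fun i => y i)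
  simp only [WithCStarModule.pi_norm, WithCStarModule.add_apply,
    WithCStarModule.equiv_symm_pi_apply] at h
  rwa [Finset.sum_coe_sort s fun n => inner C (x n + y n) (x n + y n),
    Finset.sum_coe_sort s fun n => inner C (x n) (x n),
    Finset.sum_coe_sort s fun n => inner C (y n) (y n)] at h

instance [CompleteSpace E] : CompleteSpace (HilbertSum C E) := by
  refine Metric.complete_of_cauchySeq_tendsto fun x hx => ?_
  have hcoord : ∀ n, CauchySeq fun k => (x k).1 n := fun n => by
    rw [Metric.cauchySeq_iff] at hx ⊢
    intro ε hε
    obtain ⟨N, hN⟩ := hx ε hε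
    refine ⟨N, fun k hk l hl => lt_of_le_of_lt ?_ (hN k hk l hl)⟩
    have h := norm_sum_le {n} (x k - x l)
    rw [Finset.sum_singleton, ← CStarModule.norm_eq_sqrt_norm_inner_self] at h
    rw [dist_eq_norm, dist_eq_norm]
    exact h
  choose y hy using fun n => cauchySeq_tendsto_of_complete (hcoord n)
  have key : ∀ ε > 0, ∃ N, ∀ k ≥ N, ∀ s : Finset ℕ,
      √‖∑ n ∈ s, inner C ((y n) - (x k).1 n) ((y n) - (x k).1 n)‖ ≤ ε := fun ε hε => by
    obtain ⟨N, hN⟩ := Metric.cauchySeq_iff.mp hx ε hε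
    refine ⟨N, fun k hk s => ?_⟩
    have hlim : Tendsto (fun l => √‖∑ n ∈ s, inner C ((x l).1 n - (x k).1 n)
        ((x l).1 n - (x k).1 n)‖) atTop
        (𝓝 √‖∑ n ∈ s, inner C ((y n) - (x k).1 n) ((y n) - (x k).1 n)‖) := by
      refine (continuous_norm.sqrt.tendsto _).comp (tendsto_finsetSum _ fun n _ => ?_)
      have h := (hy n).sub_const ((x k).1 n)
      exact (CStarModule.continuous_inner.tendsto _).comp (h.prodMk_nhds h)
    refine le_of_tendsto hlim ((eventually_ge_atTop N).mono fun l hl => ?_)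
    refine (norm_sum_le s (x l - x k)).trans ?_
    rw [← dist_eq_norm]
    exact (hN l hl k hk).le
  have hmem : Summable fun n => inner C (y n) (y n) := by
    refine summable_iff_vanishing_norm.mpr fun ε hε => ?_
    have hδ : 0 < √ε / 3 := by positivity
    obtain ⟨N, hN⟩ := key _ hδ
    obtain ⟨t, ht⟩ := summable_iff_vanishing_norm.mp (summable (x N) (x N)) ((√ε / 3) ^ 2)
      (by positivity)
    refine ⟨t, fun s hs => ?_⟩
    have h1 := sqrt_sum_add_le (C := C) s (fun n => y n - (x N).1 n) (x N).1
    have h2 := hN N le_rfl s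
    have h3 : √‖∑ n ∈ s, inner C ((x N).1 n) ((x N).1 n)‖ ≤ √ε / 3 :=
      Real.sqrt_le_iff.mpr ⟨hδ.le, (ht s hs).le⟩
    simp only [sub_add_cancel] at h1
    refine (Real.sqrt_lt_sqrt_iff (norm_nonneg _)).mp ?_
    have := Real.sqrt_pos.mpr hε
    linarith
  refine ⟨⟨y, hmem⟩, Metric.tendsto_atTop.mpr fun ε hε => ?_⟩
  obtain ⟨N, hN⟩ := key (ε / 2) (by positivity)
  refine ⟨N, fun k hk => ?_⟩
  rw [dist_comm, dist_eq_norm]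
  refine lt_of_le_of_lt (norm_le_of_sum fun s => ?_) (half_lt_self hε)
  exact hN k hk s

end HilbertSum

end HilbertSum

/-- The standard Hilbert `B`-module `H_B = H ⊗ B` with `H = ℓ²(ℕ)`: the right Hilbert `B`-module of
the sequences `(bₙ)` in `B` with `∑ bₙ* bₙ` norm convergent, with `⟨b, c⟩ = ∑ bₙ* cₙ`. -/
abbrev StandardModule (B : Type*) [NonUnitalCStarAlgebra B] [PartialOrder B]
    [StarOrderedRing B] : Type _ :=
  HilbertSum Bᵐᵒᵖ Bᵐᵒᵖ

end HilbertModule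

/-! It suffices that an absorbing `φ` on `E` swallows asymptotically any `ψ` on a countably
generated `F`: `φ ⊕ ψ` and `φ` are joined by a path of unitaries with compact, vanishing defect. For
absorbing `φ` and `ψ`, chain `φ`, `φ ⊕ ψ`, the flip `ψ ⊕ φ`, and `ψ`.

To swallow `ψ`, let `ψ^∞` be its infinite multiple. Absorbing the infinite multiple of `ψ^∞` gives
one isometry `V` that intertwines modulo compacts (`IsAbsorbing.exists_isometry`). A compact
operator tends to zero in norm along the summands of an infinite direct sum
(`HilbertSum.tendsto_compact_comp_single`), so the restrictions of `V` to the successive copies of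
`ψ^∞` are isometries with mutually orthogonal ranges and defects tending to zero. Joining neighbours
by quarter circles stays within isometries (`interp_isometry`) and yields a path `v` from `ψ^∞` to
`φ`.

With `S` the shift on `ψ^∞` and `ι₀` its first summand, `x = 1 - vv* + vSv*` and `y = vι₀` are
isometries with complementary ranges: an Eilenberg swindle carried out inside the range of `v`. They
form the unitary from `φ ⊕ ψ` to `φ` (`IsAbsorbing.exists_complementary_isometries`). -/

namespace HilbertModule

/-! ### Algebra and norm of adjointable operators between different modules -/

namespace Adjointable

section Basic

variable {C : Type*} [NonUnitalCStarAlgebra C] [PartialOrder C]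
variable {E : Type*} [NormedAddCommGroup E] [NormedSpace ℂ E] [SMul C E] [CStarModule C E]
variable {F : Type*} [NormedAddCommGroup F] [NormedSpace ℂ F] [SMul C F] [CStarModule C F]
variable {G : Type*} [NormedAddCommGroup G] [NormedSpace ℂ G] [SMul C G] [CStarModule C G]
variable {G' : Type*} [NormedAddCommGroup G'] [NormedSpace ℂ G'] [SMul C G'] [CStarModule C G']

lemma comp_assoc (R : Adjointable C G G') (S : Adjointable C F G) (T : Adjointable C E F) :
    (R.comp S).comp T = R.comp (S.comp T) := rfl

lemma adjoint_comp (S : Adjointable C F G) (T : Adjointable C E F) :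
    (S.comp T).adjoint = T.adjoint.comp S.adjoint := rfl

lemma adjoint_adjoint (T : Adjointable C E F) : T.adjoint.adjoint = T := rfl

lemma adjoint_add (S T : Adjointable C E F) : (S + T).adjoint = S.adjoint + T.adjoint := rfl

lemma adjoint_sub (S T : Adjointable C E F) : (S - T).adjoint = S.adjoint - T.adjoint := rfl

lemma adjoint_smul (c : ℂ) (T : Adjointable C E F) :
    (c • T).adjoint = star c • T.adjoint := ext rfl

lemma comp_add (S : Adjointable C F G) (T T' : Adjointable C E F) :
    S.comp (T + T') = S.comp T + S.comp T' :=
  ext (ContinuousLinearMap.comp_add _ _ _)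

lemma add_comp (S S' : Adjointable C F G) (T : Adjointable C E F) :
    (S + S').comp T = S.comp T + S'.comp T := ext rfl

lemma comp_sub (S : Adjointable C F G) (T T' : Adjointable C E F) :
    S.comp (T - T') = S.comp T - S.comp T' :=
  ext (ContinuousLinearMap.comp_sub _ _ _)

lemma sub_comp (S S' : Adjointable C F G) (T : Adjointable C E F) :
    (S - S').comp T = S.comp T - S'.comp T := ext rfl

lemma comp_smul (c : ℂ) (S : Adjointable C F G) (T : Adjointable C E F) :
    S.comp (c • T) = c • S.comp T :=
  ext (ContinuousLinearMap.comp_smul _ _ _)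

lemma smul_comp (c : ℂ) (S : Adjointable C F G) (T : Adjointable C E F) :
    (c • S).comp T = c • S.comp T := ext rfl

lemma id_comp (T : Adjointable C E F) : (id C F).comp T = T := rfl

lemma comp_id (T : Adjointable C E F) : T.comp (id C E) = T := rfl

lemma zero_comp (T : Adjointable C E F) : (0 : Adjointable C F G).comp T = 0 :=
  ext (ContinuousLinearMap.zero_comp _)

lemma comp_zero (S : Adjointable C F G) : S.comp (0 : Adjointable C E F) = 0 :=
  ext (ContinuousLinearMap.comp_zero _)

lemma norm_apply_le (T : Adjointable C E F) (x : E) : ‖T.toCLM x‖ ≤ ‖T‖ * ‖x‖ :=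
  T.toCLM.le_opNorm x

lemma norm_comp_le (S : Adjointable C F G) (T : Adjointable C E F) :
    ‖S.comp T‖ ≤ ‖S‖ * ‖T‖ :=
  ContinuousLinearMap.opNorm_comp_le _ _

lemma norm_le_one_of_adjoint_comp_self {V : Adjointable C E F}
    (h : V.adjoint.comp V = id C E) : ‖V‖ ≤ 1 := by
  refine ContinuousLinearMap.opNorm_le_bound _ zero_le_one fun x => ?_
  rw [one_mul]
  refine le_of_sq_le_sq ?_ (norm_nonneg _)
  have h1 : V.adj (V.toCLM x) = x := congrArg (fun T : Adjointable C E E => T.toCLM x) h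
  change ‖V.toCLM x‖ ^ 2 ≤ _
  rw [CStarModule.norm_sq_eq C, V.inner_toCLM, h1, CStarModule.norm_sq_eq C]

lemma continuous_comp :
    Continuous fun p : Adjointable C F G × Adjointable C E F => p.1.comp p.2 := by
  refine continuous_iff_continuousAt.mpr fun p => ?_
  have h1 : Tendsto (fun q : Adjointable C F G × Adjointable C E F =>
      ‖q.1 - p.1‖ * ‖q.2‖ + ‖p.1‖ * ‖q.2 - p.2‖) (𝓝 p) (𝓝 0) := by
    have : Continuous (fun q : Adjointable C F G × Adjointable C E F =>
      ‖q.1 - p.1‖ * ‖q.2‖ + ‖p.1‖ * ‖q.2 - p.2‖) := by fun_prop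
    simpa using this.tendsto p
  refine tendsto_iff_norm_sub_tendsto_zero.mpr
    (squeeze_zero (fun _ => norm_nonneg _) (fun q => ?_) h1)
  have : q.1.comp q.2 - p.1.comp p.2 = (q.1 - p.1).comp q.2 + p.1.comp (q.2 - p.2) := by
    rw [sub_comp, comp_sub]; abel
  rw [this]
  exact (norm_add_le _ _).trans (add_le_add (norm_comp_le _ _) (norm_comp_le _ _))

variable [StarOrderedRing C]

/-- Cauchy–Schwarz for `‖T*y‖² = ‖⟨y, TT*y⟩‖`, then cancel one factor `‖T*y‖`. -/
lemma norm_adjoint_le (T : Adjointable C E F) : ‖T.adjoint‖ ≤ ‖T‖ := by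
  refine ContinuousLinearMap.opNorm_le_bound _ (norm_nonneg _) fun y => ?_
  change ‖T.adj y‖ ≤ _
  have h : ‖T.adj y‖ * ‖T.adj y‖ ≤ ‖T‖ * ‖y‖ * ‖T.adj y‖ := by
    rw [← sq, CStarModule.norm_sq_eq C, T.inner_adj]
    calc _ ≤ ‖y‖ * ‖T.toCLM (T.adj y)‖ := CStarModule.norm_inner_le F
      _ ≤ ‖y‖ * (‖T‖ * ‖T.adj y‖) := by gcongr; exact T.norm_apply_le _
      _ = _ := by ring
  rcases (norm_nonneg (T.adj y)).eq_or_lt with h0 | h0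
  · rw [← h0]; positivity
  · exact le_of_mul_le_mul_right h h0

lemma norm_adjoint (T : Adjointable C E F) : ‖T.adjoint‖ = ‖T‖ :=
  le_antisymm T.norm_adjoint_le T.adjoint.norm_adjoint_le

/-- A linear map which has a left inverse that is formally adjoint to it, as an adjointable
operator. -/
def ofLeftInverse (S : E →ₗ[ℂ] F) (R : F →ₗ[ℂ] E)
    (h : ∀ x y, inner C (S x) y = inner C x (R y)) (hRS : ∀ x, R (S x) = x) :
    Adjointable C E F :=
  have hS : ∀ x, ‖S x‖ ≤ 1 * ‖x‖ := fun x => by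
    rw [one_mul]
    refine le_of_sq_le_sq ?_ (norm_nonneg _)
    rw [CStarModule.norm_sq_eq C, h, hRS, CStarModule.norm_sq_eq C]
  { toCLM := S.mkContinuous 1 hS
    -- `S` is contractive, so `‖Ry‖² = ‖⟨y, SRy⟩‖ ≤ ‖y‖ ‖Ry‖`.
    adj := R.mkContinuous 1 fun y => by
      have h' : inner C (R y) (R y) = inner C y (S (R y)) := by
        rw [← CStarModule.star_inner, ← h, CStarModule.star_inner]
      have h1 : ‖R y‖ * ‖R y‖ ≤ 1 * ‖y‖ * ‖R y‖ := by
        rw [← sq, CStarModule.norm_sq_eq C, h']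
        calc _ ≤ ‖y‖ * ‖S (R y)‖ := CStarModule.norm_inner_le F
          _ ≤ ‖y‖ * (1 * ‖R y‖) := by gcongr; exact hS _
          _ = _ := by ring
      rcases (norm_nonneg (R y)).eq_or_lt with h0 | h0
      · rw [← h0]; positivity
      · exact le_of_mul_le_mul_right h1 h0
    inner_toCLM := h }

lemma continuous_adjoint : Continuous (adjoint : Adjointable C E F → Adjointable C F E) := by
  refine LipschitzWith.continuous (K := 1) (LipschitzWith.of_dist_le_mul fun S T => ?_)
  rw [dist_eq_norm, dist_eq_norm, ← adjoint_sub, norm_adjoint, NNReal.coe_one, one_mul]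

end Basic

end Adjointable

/-! ### Compact operators as a two-sided ideal closed under adjoints -/

section Compacts

open Adjointable

variable {C : Type*} [NonUnitalCStarAlgebra C] [PartialOrder C] [StarOrderedRing C]
variable {E : Type*} [NormedAddCommGroup E] [NormedSpace ℂ E] [SMul C E] [CStarModule C E]
variable {F : Type*} [NormedAddCommGroup F] [NormedSpace ℂ F] [SMul C F] [CStarModule C F]
variable {G : Type*} [NormedAddCommGroup G] [NormedSpace ℂ G] [SMul C G] [CStarModule C G]

lemma compacts_induction {p : Adjointable C E F → Prop} (hcl : IsClosed {K | p K})
    (hrank : ∀ y x, p (rankOne y x)) (hadd : ∀ S T, p S → p T → p (S + T)) (hzero : p 0)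
    (hsmul : ∀ (c : ℂ) T, p T → p (c • T)) {K : Adjointable C E F}
    (hK : K ∈ compacts C E F) : p K := by
  refine closure_minimal (s := (Submodule.span ℂ (Set.range fun q : F × E =>
    rankOne (C := C) q.1 q.2) : Set (Adjointable C E F))) (fun T hT => ?_) hcl hK
  exact Submodule.span_induction (fun _ ⟨q, hq⟩ => hq ▸ hrank _ _) hzero
    (fun S T _ _ => hadd S T) (fun c T _ => hsmul c T) hT

lemma isClosed_compacts : IsClosed (compacts C E F : Set (Adjointable C E F)) :=
  Submodule.isClosed_topologicalClosure _

lemma rankOne_mem_compacts (y : F) (x : E) : rankOne y x ∈ compacts C E F :=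
  Submodule.le_topologicalClosure _ (Submodule.subset_span ⟨(y, x), rfl⟩)

lemma toCLM_rankOne (y : F) (x z : E) : (rankOne (C := C) y x).toCLM z = inner C x z • y := rfl

/-- Rests on the `C`-linearity of `T`, which is not part of the structure but follows from the
adjoint by testing against inner products. -/
lemma comp_rankOne (T : Adjointable C F G) (y : F) (x : E) :
    T.comp (rankOne y x) = rankOne (T.toCLM y) x := by
  refine Adjointable.ext (ContinuousLinearMap.ext fun z => eq_of_inner (C := C) fun w => ?_)
  change inner C w (T.toCLM ((rankOne y x).toCLM z)) = _
  rw [← T.inner_adj, toCLM_rankOne, toCLM_rankOne, CStarModule.inner_op_smul_right,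
    CStarModule.inner_op_smul_right, T.inner_adj]

lemma comp_mem_compacts (T : Adjointable C F G) {K : Adjointable C E F}
    (hK : K ∈ compacts C E F) : T.comp K ∈ compacts C E G := by
  refine compacts_induction (p := fun K => T.comp K ∈ compacts C E G) ?_ (fun y x => ?_)
    (fun S S' h h' => ?_) ?_ (fun c S h => ?_) hK
  · exact isClosed_compacts.preimage (continuous_comp.comp (by fun_prop :
      Continuous fun K : Adjointable C E F => (T, K)))
  · rw [comp_rankOne]; exact rankOne_mem_compacts _ _
  · rw [comp_add]; exact add_mem h h'
  · rw [comp_zero]; exact zero_mem _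
  · rw [comp_smul]; exact Submodule.smul_mem _ _ h

lemma adjoint_mem_compacts {K : Adjointable C E F} (hK : K ∈ compacts C E F) :
    K.adjoint ∈ compacts C F E := by
  refine compacts_induction (p := fun K => K.adjoint ∈ compacts C F E) ?_ (fun y x => ?_)
    (fun S S' h h' => ?_) ?_ (fun c S h => ?_) hK
  · exact isClosed_compacts.preimage continuous_adjoint
  · exact rankOne_mem_compacts _ _
  · exact add_mem h h'
  · exact zero_mem _
  · rw [adjoint_smul]; exact Submodule.smul_mem _ _ h

/-- Adjoints turn right multiplication into left multiplication. -/
lemma mem_compacts_comp {K : Adjointable C F G} (hK : K ∈ compacts C F G)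
    (T : Adjointable C E F) : K.comp T ∈ compacts C E G :=
  adjoint_mem_compacts (comp_mem_compacts T.adjoint (adjoint_mem_compacts hK))

end Compacts

open Adjointable

/-! ### The second summand of a direct sum of two modules -/

section Sum

variable {C : Type*} [NonUnitalCStarAlgebra C] [PartialOrder C] [StarOrderedRing C]
variable {E : Type*} [NormedAddCommGroup E] [NormedSpace ℂ E] [SMul C E] [CStarModule C E]
variable {F : Type*} [NormedAddCommGroup F] [NormedSpace ℂ F] [SMul C F] [CStarModule C F]

variable (C E F) in
/-- The inclusion of the second summand in `E ⊕ F`. -/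
noncomputable def sumInr : Adjointable C F C⋆ᵐᵒᵈ(C, E × F) :=
  ofLeftInverse
    ((WithCStarModule.linearEquiv ℂ C (E × F)).symm.toLinearMap ∘ₗ LinearMap.inr ℂ E F)
    (LinearMap.snd ℂ E F ∘ₗ (WithCStarModule.linearEquiv ℂ C (E × F)).toLinearMap)
    (fun x y => by
      change inner C (0 : E) y.1 + inner C x y.2 = inner C x y.2
      simp)
    (fun _ => rfl)

lemma sumInr_isometry : (sumInr C E F).adjoint.comp (sumInr C E F) = .id C F :=
  Adjointable.ext rfl

lemma directSum_comp_sumInr (S : Adjointable C E E) (T : Adjointable C F F) :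
    (S.directSum T).comp (sumInr C E F) = (sumInr C E F).comp T := by
  refine Adjointable.ext (ContinuousLinearMap.ext fun x => ?_)
  refine (WithCStarModule.equiv C (E × F)).injective (Prod.ext ?_ rfl)
  exact map_zero S.toCLM

end Sum

/-! ### Summand inclusions and the shift on the infinite direct sum -/

namespace HilbertSum

lemma tendsto_norm_val {C : Type*} [NonUnitalCStarAlgebra C] [PartialOrder C]
    {E : Type*} [NormedAddCommGroup E] [NormedSpace ℂ E] [SMul C E] [CStarModule C E]
    (x : HilbertSum C E) : Tendsto (fun n => ‖x.val n‖) atTop (𝓝 0) := by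
  have h := (continuous_norm.sqrt.tendsto _).comp x.summable_self.tendsto_atTop_zero
  simp only [norm_zero, Real.sqrt_zero] at h
  refine h.congr fun n => ?_
  exact (CStarModule.norm_eq_sqrt_norm_inner_self (A := C) (x.val n)).symm

variable {C : Type*} [NonUnitalCStarAlgebra C] [PartialOrder C] [StarOrderedRing C]
variable {E : Type*} [NormedAddCommGroup E] [NormedSpace ℂ E] [SMul C E] [CStarModule C E]
variable {F : Type*} [NormedAddCommGroup F] [NormedSpace ℂ F] [SMul C F] [CStarModule C F]

lemma inner_eq_tsum (x y : HilbertSum C E) :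
    inner C x y = ∑' n, inner C (x.val n) (y.val n) := rfl

variable (C E) in
/-- The `n`-th coordinate, as a linear map. -/
def coordₗ (n : ℕ) : HilbertSum C E →ₗ[ℂ] E where
  toFun x := x.val n
  map_add' _ _ := rfl
  map_smul' _ _ := rfl

variable (C E) in
/-- The sequence with `n`-th entry `x` and zero entries elsewhere, as a linear map in `x`. -/
def singleₗ (n : ℕ) : E →ₗ[ℂ] HilbertSum C E where
  toFun x := ⟨Pi.single n x, summable_of_ne_finset_zero (s := {n}) fun k hk => by
    rw [Pi.single_eq_of_ne (by simpa using hk)]; simp⟩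
  map_add' x y := HilbertSum.ext (Pi.single_add (f := fun _ => E) n x y)
  map_smul' c x := HilbertSum.ext (funext fun k => by
    change Pi.single (M := fun _ => E) n (c • x) k = c • Pi.single (M := fun _ => E) n x k
    by_cases h : k = n
    · subst h; simp
    · simp [h])

variable (C E) in
/-- The inclusion of the `n`-th summand. -/
noncomputable def single (n : ℕ) : Adjointable C E (HilbertSum C E) :=
  ofLeftInverse (singleₗ C E n) (coordₗ C E n)
    (fun x y => by
      rw [inner_eq_tsum, tsum_eq_single n fun k hk => by simp [singleₗ, hk]]
      simp [singleₗ, coordₗ])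
    (fun x => Pi.single_eq_same (M := fun _ => E) n x)

lemma single_isometry (n : ℕ) : (single C E n).adjoint.comp (single C E n) = .id C E :=
  Adjointable.ext (ContinuousLinearMap.ext fun x => Pi.single_eq_same (M := fun _ => E) n x)

lemma single_orthogonal {m n : ℕ} (h : m ≠ n) :
    (single C E m).adjoint.comp (single C E n) = 0 :=
  Adjointable.ext (ContinuousLinearMap.ext fun x => Pi.single_eq_of_ne (M := fun _ => E) h x)

variable (C E) in
/-- The unilateral shift, as a linear map. -/
def shiftₗ : HilbertSum C E →ₗ[ℂ] HilbertSum C E where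
  toFun x := ⟨fun n => n.casesOn 0 x.val, by
    rw [← summable_nat_add_iff 1]; exact x.summable_self⟩
  map_add' x y := HilbertSum.ext (funext fun n => by
    cases n
    · exact (add_zero _).symm
    · rfl)
  map_smul' c x := HilbertSum.ext (funext fun n => by
    cases n
    · exact (smul_zero _).symm
    · rfl)

variable (C E) in
/-- The backward shift, as a linear map. -/
def tailₗ : HilbertSum C E →ₗ[ℂ] HilbertSum C E where
  toFun x := ⟨fun n => x.val (n + 1), (summable_nat_add_iff 1).mpr x.summable_self⟩
  map_add' _ _ := rfl
  map_smul' _ _ := rfl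

variable (C E) in
/-- The unilateral shift. -/
noncomputable def shift : Adjointable C (HilbertSum C E) (HilbertSum C E) :=
  ofLeftInverse (shiftₗ C E) (tailₗ C E)
    (fun x y => by
      rw [inner_eq_tsum, (summable _ _).tsum_eq_zero_add]
      change inner C (0 : E) _ + _ = _
      rw [CStarModule.inner_zero_left, zero_add]
      rfl)
    (fun _ => rfl)

lemma shift_isometry : (shift C E).adjoint.comp (shift C E) = .id C (HilbertSum C E) := rfl

lemma shift_adjoint_comp_single_zero : (shift C E).adjoint.comp (single C E 0) = 0 :=
  Adjointable.ext (ContinuousLinearMap.ext fun x => HilbertSum.ext (funext fun n =>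
    Pi.single_eq_of_ne (M := fun _ => E) n.succ_ne_zero x))

/-- The shift vacates exactly the first summand; this is what will make the ranges in the swindle
complementary. -/
lemma shift_single_range : (shift C E).comp (shift C E).adjoint +
    (single C E 0).comp (single C E 0).adjoint = .id C (HilbertSum C E) := by
  refine Adjointable.ext (ContinuousLinearMap.ext fun x => HilbertSum.ext (funext fun n => ?_))
  cases n with
  | zero =>
    exact (zero_add (Pi.single (M := fun _ => E) 0 (x.val 0) 0)).trans (Pi.single_eq_same (M := fun _ => E) 0 (x.val 0))
  | succ n =>
    exact (congrArg (x.val (n + 1) + ·)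
      (Pi.single_eq_of_ne (M := fun _ => E) n.succ_ne_zero (x.val 0))).trans (add_zero _)

/-! ### Ampliations -/

/-- Let `L` be the supremum of the left side over all contractions `R`. Moving `R` across gives `∑
⟨xₙ, R*R xₙ⟩`, and `R*R` is again a contraction, so Cauchy–Schwarz yields `L ≤ √m √L`, hence `L ≤
m`. No functional calculus in `𝓛(E)` and no completeness of `E` enters. -/
lemma norm_sum_inner_apply_le_of_norm_le_one (s : Finset ℕ) (x : ℕ → E) {T : Adjointable C E E}
    (hT : ‖T‖ ≤ 1) : ‖∑ n ∈ s, inner C (T.toCLM (x n)) (T.toCLM (x n))‖ ≤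
      ‖∑ n ∈ s, inner C (x n) (x n)‖ := by
  set m := ‖∑ n ∈ s, inner C (x n) (x n)‖
  let g : Adjointable C E E → ℝ := fun R => ‖∑ n ∈ s, inner C (R.toCLM (x n)) (R.toCLM (x n))‖
  let I : Set ℝ := g '' {R | ‖R‖ ≤ 1}
  -- A crude bound, needed only because `sSup` of an unbounded set of reals is the default value 0.
  have hbdd : BddAbove I := by
    refine ⟨∑ n ∈ s, ‖x n‖ ^ 2, ?_⟩
    rintro _ ⟨R, hR, rfl⟩
    refine (_root_.norm_sum_le _ _).trans (Finset.sum_le_sum fun n _ => ?_)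
    rw [← CStarModule.norm_sq_eq C]
    gcongr
    exact (R.norm_apply_le _).trans (mul_le_of_le_one_left (norm_nonneg _) hR)
  have hm : 0 ≤ m := norm_nonneg _
  have hle : ∀ R : Adjointable C E E, ‖R‖ ≤ 1 → g R ≤ sSup I :=
    fun R hR => le_csSup hbdd ⟨R, hR, rfl⟩
  have hL : 0 ≤ sSup I := (norm_nonneg _).trans (hle T hT)
  have hsq : ∀ R : Adjointable C E E, ‖R‖ ≤ 1 → g R ≤ √m * √(sSup I) := fun R hR => by
    have h : g R = ‖∑ n ∈ s, inner C (x n) ((R.adjoint.comp R).toCLM (x n))‖ :=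
      congrArg _ (Finset.sum_congr rfl fun n _ => R.inner_toCLM _ _)
    rw [h]
    refine (norm_sum_inner_le s _ _).trans ?_
    gcongr
    refine hle _ ((norm_comp_le _ _).trans ?_)
    rw [norm_adjoint]
    exact mul_le_one₀ hR (norm_nonneg _) hR
  have hsup : sSup I ≤ √m * √(sSup I) :=
    csSup_le ⟨_, T, hT, rfl⟩ (by rintro _ ⟨R, hR, rfl⟩; exact hsq R hR)
  refine (hle T hT).trans ?_
  have h1 : √(sSup I) ≤ √m := by
    rcases (Real.sqrt_nonneg (sSup I)).eq_or_lt with h0 | h0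
    · rw [← h0]; positivity
    · refine le_of_mul_le_mul_right ?_ h0
      rwa [Real.mul_self_sqrt hL]
  exact (Real.sqrt_le_sqrt_iff hm).mp h1

lemma norm_sum_inner_apply_le (s : Finset ℕ) (x : ℕ → E) (T : Adjointable C E E) :
    ‖∑ n ∈ s, inner C (T.toCLM (x n)) (T.toCLM (x n))‖ ≤
      ‖T‖ ^ 2 * ‖∑ n ∈ s, inner C (x n) (x n)‖ := by
  rcases eq_or_ne T 0 with rfl | hT
  · have h : ∀ n, (0 : Adjointable C E E).toCLM (x n) = 0 := fun n => rfl
    simp [h]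
  have hT' : ‖T‖ ≠ 0 := norm_ne_zero_iff.mpr hT
  have hc : (‖T‖ : ℂ) ≠ 0 := by exact_mod_cast hT'
  set R : Adjointable C E E := (‖T‖ : ℂ)⁻¹ • T with hR
  have hR1 : ‖R‖ ≤ 1 := by
    rw [hR, norm_smul, norm_inv, Complex.norm_real, norm_norm, inv_mul_cancel₀ hT']
  have hTR : ∀ n, T.toCLM (x n) = (‖T‖ : ℂ) • R.toCLM (x n) := fun n => by
    change _ = (‖T‖ : ℂ) • (‖T‖ : ℂ)⁻¹ • T.toCLM (x n)
    rw [smul_inv_smul₀ hc]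
  have h := norm_sum_inner_apply_le_of_norm_le_one s x hR1
  simp_rw [hTR, CStarModule.inner_smul_left_complex, CStarModule.inner_smul_right_complex,
    ← Finset.smul_sum, norm_smul, norm_star, Complex.norm_real, norm_norm]
  rw [← mul_assoc, ← sq]
  gcongr

lemma summable_inner_apply (T : Adjointable C E E) (x : HilbertSum C E) :
    Summable fun n => inner C (T.toCLM (x.val n)) (T.toCLM (x.val n)) := by
  refine summable_iff_vanishing_norm.mpr fun ε hε => ?_
  -- The `+ 1` keeps the denominator positive when `T = 0`.
  obtain ⟨t, ht⟩ := summable_iff_vanishing_norm.mp x.summable_self (ε / (‖T‖ ^ 2 + 1))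
    (by positivity)
  refine ⟨t, fun s hs => (norm_sum_inner_apply_le s _ T).trans_lt ?_⟩
  have h := (lt_div_iff₀ (by positivity)).mp (ht s hs)
  nlinarith [norm_nonneg (∑ n ∈ s, inner C (x.val n) (x.val n))]

/-- The coordinatewise action of an adjointable operator on sequences, as a bounded operator. -/
noncomputable def mapCLM (T : Adjointable C E E) : HilbertSum C E →L[ℂ] HilbertSum C E :=
  LinearMap.mkContinuous
    { toFun := fun x => ⟨fun n => T.toCLM (x.val n), summable_inner_apply T x⟩
      map_add' := fun x y => HilbertSum.ext (funext fun n => map_add T.toCLM _ _)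
      map_smul' := fun c x => HilbertSum.ext (funext fun n => map_smul T.toCLM _ _) }
    ‖T‖ fun x => norm_le_of_sum fun s => by
      refine (Real.sqrt_le_sqrt (norm_sum_inner_apply_le s _ T)).trans ?_
      rw [Real.sqrt_mul (by positivity), Real.sqrt_sq (norm_nonneg _)]
      gcongr
      exact norm_sum_le s x

/-- The ampliation `T ⊕ T ⊕ ⋯` of an adjointable operator. -/
noncomputable def ampliation (T : Adjointable C E E) :
    Adjointable C (HilbertSum C E) (HilbertSum C E) where
  toCLM := mapCLM T
  adj := mapCLM T.adjoint
  inner_toCLM _ _ := tsum_congr fun _ => T.inner_toCLM _ _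

lemma ext_of_val {S T : Adjointable C (HilbertSum C E) (HilbertSum C E)}
    (h : ∀ x n, (S.toCLM x).val n = (T.toCLM x).val n) : S = T :=
  Adjointable.ext (ContinuousLinearMap.ext fun x => HilbertSum.ext (funext (h x)))

lemma ampliation_comp_single (T : Adjointable C E E) (n : ℕ) :
    (ampliation T).comp (single C E n) = (single C E n).comp T := by
  refine Adjointable.ext (ContinuousLinearMap.ext fun x => HilbertSum.ext (funext fun k => ?_))
  change T.toCLM (Pi.single (M := fun _ => E) n x k) = Pi.single (M := fun _ => E) n (T.toCLM x) k
  exact Pi.apply_single (fun _ => T.toCLM) (fun _ => map_zero _) n x k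

lemma ampliation_comp_shift (T : Adjointable C E E) :
    (ampliation T).comp (shift C E) = (shift C E).comp (ampliation T) :=
  ext_of_val fun x n => by
    cases n with
    | zero => exact map_zero T.toCLM
    | succ n => rfl

/-! ### Countable generation -/

/-- Finitely supported sequences are dense: cutting `x` off outside a large finite set leaves a tail
of small norm. -/
lemma eq_top_of_single_mem (M : Submodule ℂ (HilbertSum C E))
    (hM : IsClosed (M : Set (HilbertSum C E))) (h : ∀ n x, (single C E n).toCLM x ∈ M) :
    M = ⊤ := by
  refine (Submodule.eq_top_iff').mpr fun x => ?_
  refine hM.closure_subset (Metric.mem_closure_iff.mpr fun ε hε => ?_)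
  obtain ⟨t, ht⟩ := summable_iff_vanishing_norm.mp x.summable_self ((ε / 2) ^ 2) (by positivity)
  refine ⟨∑ n ∈ t, (single C E n).toCLM (x.val n), M.sum_mem fun n _ => h n _, ?_⟩
  rw [dist_eq_norm]
  refine lt_of_le_of_lt (norm_le_of_sum fun s => ?_) (half_lt_self hε)
  have hval : ∀ k, (x - ∑ n ∈ t, (single C E n).toCLM (x.val n)).val k =
      if k ∈ t then 0 else x.val k := fun k => by
    change coordₗ C E k (x - _) = _
    rw [map_sub, map_sum]
    change x.val k - ∑ n ∈ t, Pi.single (M := fun _ => E) n (x.val n) k = _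
    rw [Finset.sum_pi_single]
    split_ifs <;> simp
  have hsum : ∑ k ∈ s, inner C ((x - ∑ n ∈ t, (single C E n).toCLM (x.val n)).val k)
      ((x - ∑ n ∈ t, (single C E n).toCLM (x.val n)).val k) =
      ∑ k ∈ s \ t, inner C (x.val k) (x.val k) := by
    rw [Finset.sdiff_eq_filter, Finset.sum_filter]
    refine Finset.sum_congr rfl fun k _ => ?_
    rw [hval]
    split_ifs <;> simp
  rw [hsum]
  exact Real.sqrt_le_iff.mpr ⟨by positivity, (ht _ Finset.sdiff_disjoint).le⟩

lemma single_smul (n : ℕ) (c : C) (x : E) :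
    (single C E n).toCLM (c • x) = c • (single C E n).toCLM x :=
  eq_of_inner (C := C) fun z => by
    rw [← (single C E n).inner_adj, CStarModule.inner_op_smul_right,
      CStarModule.inner_op_smul_right, (single C E n).inner_adj]

lemma countablyGenerated (h : CountablyGenerated C E) :
    CountablyGenerated C (HilbertSum C E) := by
  obtain ⟨S, hS, hE⟩ := h
  refine ⟨⋃ n, (single C E n).toCLM '' S, Set.countable_iUnion fun n => hS.image _, ?_⟩
  refine eq_top_of_single_mem _ (Submodule.isClosed_topologicalClosure _)
    fun n x => ?_
  have hx : x ∈ (Submodule.span ℂ {y : E | ∃ x ∈ S, ∃ c : C, y = c • x}).topologicalClosure :=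
    hE ▸ Submodule.mem_top
  revert x
  -- The preimage under the inclusion is a closed subspace, so it is enough to test generators of
  -- `E`.
  change _ ≤ (Submodule.topologicalClosure _).comap (single C E n).toCLM.toLinearMap
  refine Submodule.topologicalClosure_minimal _ (Submodule.span_le.mpr ?_)
    ((Submodule.isClosed_topologicalClosure _).preimage (single C E n).toCLM.continuous)
  rintro _ ⟨y, hy, c, rfl⟩
  refine Submodule.le_topologicalClosure _ (Submodule.subset_span ?_)
  exact ⟨_, Set.mem_iUnion.mpr ⟨n, y, hy, rfl⟩, c, single_smul n c y⟩

/-! ### Compact operators on the sum -/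

lemma norm_single_le (n : ℕ) : ‖single C E n‖ ≤ 1 :=
  norm_le_one_of_adjoint_comp_self (single_isometry n)

lemma norm_rankOne_le (y : F) (x : E) : ‖rankOne (C := C) y x‖ ≤ ‖x‖ * ‖y‖ := by
  refine ContinuousLinearMap.opNorm_le_bound _ (by positivity) fun z => ?_
  refine (norm_op_smul_le (C := C) (inner C x z) y).trans ?_
  rw [mul_right_comm]
  gcongr
  exact CStarModule.norm_inner_le E

/-- Restricting `θ_{y,x}` to the `n`-th summand gives `θ_{y,xₙ}`, and `xₙ → 0`. The inclusions are
uniformly contractive, so the property survives norm limits. This turns a single compact defect into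
a null sequence of defects. -/
lemma tendsto_compact_comp_single {K : Adjointable C (HilbertSum C E) F}
    (hK : K ∈ compacts C (HilbertSum C E) F) :
    Tendsto (fun n => K.comp (single C E n)) atTop (𝓝 0) := by
  refine compacts_induction
    (p := fun K => Tendsto (fun n => K.comp (single C E n)) atTop (𝓝 0)) ?_ (fun y x => ?_)
    (fun S T hS hT => ?_) ?_ (fun c T hT => ?_) hK
  · refine isClosed_of_closure_subset fun K hK => Metric.tendsto_atTop.mpr fun ε hε => ?_
    obtain ⟨L, hL, hKL⟩ := Metric.mem_closure_iff.mp hK (ε / 2) (by positivity)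
    obtain ⟨N, hN⟩ := Metric.tendsto_atTop.mp hL (ε / 2) (by positivity)
    refine ⟨N, fun n hn => ?_⟩
    have h1 := hN n hn
    rw [dist_zero_right] at h1 ⊢
    rw [dist_eq_norm] at hKL
    have h2 : K.comp (single C E n) = (K - L).comp (single C E n) + L.comp (single C E n) := by
      rw [← add_comp, sub_add_cancel]
    have h3 := (norm_comp_le (K - L) (single C E n)).trans
      (mul_le_of_le_one_right (norm_nonneg _) (norm_single_le n))
    rw [h2]
    exact (norm_add_le _ _).trans_lt (by linarith)
  · have h : ∀ n, (rankOne (C := C) y x).comp (single C E n) = rankOne y (x.val n) := fun n => by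
      have := congrArg adjoint (comp_rankOne (C := C) (single C E n).adjoint x y)
      exact this
    simp_rw [h]
    refine squeeze_zero_norm (fun n => norm_rankOne_le y (x.val n)) ?_
    simpa using (tendsto_norm_val x).mul_const ‖y‖
  · simpa [add_comp] using hS.add hT
  · simp [zero_comp]
  · simpa [smul_comp] using hT.const_smul c

end HilbertSum

/-! ### Countable generation of a separable algebra over itself -/

section Separable

lemma countablyGenerated_self {C : Type*} [NonUnitalCStarAlgebra C] [PartialOrder C]
    [StarOrderedRing C] [TopologicalSpace.SeparableSpace C] : CountablyGenerated C C := by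
  obtain ⟨S, hS, hd⟩ := TopologicalSpace.exists_countable_dense C
  refine ⟨S, hS, (Submodule.eq_top_iff').mpr fun x => ?_⟩
  set M := (Submodule.span ℂ {y : C | ∃ x ∈ S, ∃ c : C, y = c • x}).topologicalClosure
  have hcl : IsClosed (M : Set C) := Submodule.isClosed_topologicalClosure _
  -- Products with `y` in the dense set are generators; continuity covers all `y`. An approximate
  -- unit then recovers `x` as a limit of products `c * x`.
  have hmul : ∀ c y : C, c * y ∈ M := fun c y => by
    have hc : IsClosed {y : C | c * y ∈ M} := hcl.preimage (continuous_const_mul c)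
    have hsub : S ⊆ {y : C | c * y ∈ M} := fun y hy =>
      Submodule.le_topologicalClosure _ (Submodule.subset_span ⟨y, hy, c, rfl⟩)
    exact closure_minimal hsub hc (hd y)
  have hu := CStarAlgebra.increasingApproximateUnit C
  have := hu.neBot
  exact hcl.mem_of_tendsto (hu.tendsto_mul_right x) (Eventually.of_forall fun c => hmul c x)

end Separable

open Adjointable

/-! ### Interpolation of sequences -/

section Interp

variable {X : Type*} [NormedAddCommGroup X] [NormedSpace ℂ X]

/-- The path that joins `x n` to `x (n + 1)` along a quarter of a circle, for each `n`. -/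
noncomputable def interp (x : ℕ → X) (t : ℝ≥0) : X :=
  ((√(1 - (t - ⌊t⌋₊)) : ℝ) : ℂ) • x ⌊t⌋₊ + ((√(t - ⌊t⌋₊) : ℝ) : ℂ) • x (⌊t⌋₊ + 1)

/-- The formula persists at the right endpoint, where the floor jumps, so the pieces glue
continuously over the locally finite cover by closed unit intervals. -/
lemma interp_of_mem_Icc (x : ℕ → X) {t : ℝ≥0} {n : ℕ} (ht : t ∈ Set.Icc (n : ℝ≥0) (n + 1)) :
    interp x t = ((√(1 - (t - n)) : ℝ) : ℂ) • x n + ((√(t - n) : ℝ) : ℂ) • x (n + 1) := by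
  rcases ht.2.eq_or_lt with h | h
  · subst h
    have hf : ⌊(n : ℝ≥0) + 1⌋₊ = n + 1 := by exact_mod_cast Nat.floor_natCast (R := ℝ≥0) (n + 1)
    rw [interp, hf]
    simp
  · rw [interp, (Nat.floor_eq_iff zero_le).mpr ⟨ht.1, h⟩]

lemma continuous_interp (x : ℕ → X) : Continuous (interp x) := by
  have htop : Tendsto (fun n : ℕ => (n : ℝ≥0)) atTop atTop := tendsto_natCast_atTop_atTop
  have hlf : LocallyFinite fun n : ℕ => Set.Icc (n : ℝ≥0) (n + 1) := by
    intro t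
    refine ⟨Set.Iio (t + 1), Iio_mem_nhds (lt_add_one t), ?_⟩
    refine (Set.finite_Iio (⌈t + 1⌉₊)).subset fun n ⟨s, hs, hst⟩ => ?_
    exact Nat.lt_ceil.mpr (hs.1.trans_lt hst)
  refine hlf.continuous ?_ (fun n => isClosed_Icc) fun n => ?_
  · refine Set.iUnion_eq_univ_iff.mpr fun t => ⟨⌊t⌋₊, ?_, (Nat.lt_floor_add_one t).le⟩
    exact Nat.floor_le zero_le
  · refine ContinuousOn.congr (Continuous.continuousOn ?_) fun t ht => interp_of_mem_Icc x ht
    fun_prop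

lemma sub_floor_mem (t : ℝ≥0) : (t : ℝ) - ⌊t⌋₊ ∈ Set.Icc (0 : ℝ) 1 := by
  have h1 : (⌊t⌋₊ : ℝ) ≤ t := by exact_mod_cast Nat.floor_le zero_le
  have h2 : (t : ℝ) < ⌊t⌋₊ + 1 := by exact_mod_cast Nat.lt_floor_add_one t
  exact ⟨by linarith, by linarith⟩

lemma norm_interp_le (x : ℕ → X) (t : ℝ≥0) :
    ‖interp x t‖ ≤ ‖x ⌊t⌋₊‖ + ‖x (⌊t⌋₊ + 1)‖ := by
  obtain ⟨h0, h1⟩ := sub_floor_mem t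
  refine (norm_add_le _ _).trans (add_le_add ?_ ?_) <;>
  · rw [norm_smul, Complex.norm_real, Real.norm_of_nonneg (Real.sqrt_nonneg _)]
    exact mul_le_of_le_one_left (norm_nonneg _) (Real.sqrt_le_one.mpr (by linarith))

lemma tendsto_interp_zero {x : ℕ → X} (hx : Tendsto x atTop (𝓝 0)) :
    Tendsto (interp x) atTop (𝓝 0) := by
  have h := hx.norm.add (hx.comp (tendsto_add_atTop_nat 1)).norm
  simp only [norm_zero, add_zero] at h
  exact squeeze_zero_norm (norm_interp_le x) (h.comp (tendsto_nat_floor_atTop (α := ℝ≥0)))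

end Interp

/-! ### Asymptotic intertwiners -/

section Intertwiners

variable {A : Type*} [NonUnitalCStarAlgebra A]
variable {C : Type*} [NonUnitalCStarAlgebra C] [PartialOrder C]
variable {E : Type*} [NormedAddCommGroup E] [NormedSpace ℂ E] [SMul C E] [CStarModule C E]
variable {F : Type*} [NormedAddCommGroup F] [NormedSpace ℂ F] [SMul C F] [CStarModule C F]
variable {G : Type*} [NormedAddCommGroup G] [NormedSpace ℂ G] [SMul C G] [CStarModule C G]

/-- A bounded norm continuous path of operators. -/
structure IsBoundedPath (w : ℝ≥0 → Adjointable C E F) : Prop where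
  continuous : Continuous w
  bounded : ∃ M, ∀ t, ‖w t‖ ≤ M

namespace IsBoundedPath

variable {w w' : ℝ≥0 → Adjointable C E F} {z : ℝ≥0 → Adjointable C F G}

lemma const (T : Adjointable C E F) : IsBoundedPath fun _ => T :=
  ⟨continuous_const, ‖T‖, fun _ => le_rfl⟩

lemma add (h : IsBoundedPath w) (h' : IsBoundedPath w') : IsBoundedPath fun t => w t + w' t :=
  have ⟨M, hM⟩ := h.bounded
  have ⟨M', hM'⟩ := h'.bounded
  ⟨h.continuous.add h'.continuous, M + M',
    fun t => (norm_add_le _ _).trans (add_le_add (hM t) (hM' t))⟩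

lemma sub (h : IsBoundedPath w) (h' : IsBoundedPath w') : IsBoundedPath fun t => w t - w' t :=
  have ⟨M, hM⟩ := h.bounded
  have ⟨M', hM'⟩ := h'.bounded
  ⟨h.continuous.sub h'.continuous, M + M',
    fun t => (norm_sub_le _ _).trans (add_le_add (hM t) (hM' t))⟩

lemma comp (hz : IsBoundedPath z) (hw : IsBoundedPath w) :
    IsBoundedPath fun t => (z t).comp (w t) :=
  have ⟨M, hM⟩ := hz.bounded
  have ⟨M', hM'⟩ := hw.bounded
  ⟨continuous_comp.comp (hz.continuous.prodMk hw.continuous), M * M', fun t =>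
    (norm_comp_le _ _).trans
      (mul_le_mul (hM t) (hM' t) (norm_nonneg _) ((norm_nonneg _).trans (hM t)))⟩

end IsBoundedPath

lemma interp_comp (V : ℕ → Adjointable C F G) (T : Adjointable C E F) (t : ℝ≥0) :
    (interp V t).comp T = interp (fun n => (V n).comp T) t := by
  rw [interp, add_comp, smul_comp, smul_comp]; rfl

lemma comp_interp (S : Adjointable C F G) (V : ℕ → Adjointable C E F) (t : ℝ≥0) :
    S.comp (interp V t) = interp (fun n => S.comp (V n)) t := by
  rw [interp, comp_add, comp_smul, comp_smul]; rfl

/-- Orthogonality kills the cross terms and the squared coefficients sum to 1, which is why they are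
square roots rather than affine weights. -/
lemma interp_isometry {V : ℕ → Adjointable C E F}
    (h1 : ∀ n, (V n).adjoint.comp (V n) = .id C E)
    (h0 : ∀ m n, m ≠ n → (V m).adjoint.comp (V n) = 0) (t : ℝ≥0) :
    (interp V t).adjoint.comp (interp V t) = .id C E := by
  obtain ⟨ht0, ht1⟩ := sub_floor_mem t
  have hc : ((√(1 - (t - ⌊t⌋₊)) : ℝ) : ℂ) * ((√(1 - (t - ⌊t⌋₊)) : ℝ) : ℂ) +
      ((√(t - ⌊t⌋₊) : ℝ) : ℂ) * ((√(t - ⌊t⌋₊) : ℝ) : ℂ) = 1 := by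
    rw [← Complex.ofReal_mul, ← Complex.ofReal_mul, Real.mul_self_sqrt ht0,
      Real.mul_self_sqrt (sub_nonneg.mpr ht1), ← Complex.ofReal_add]
    simp
  simp only [interp, adjoint_add, adjoint_smul, add_comp, comp_add, smul_comp, comp_smul, h1,
    h0 _ _ (Nat.succ_ne_self _), h0 _ _ (Nat.succ_ne_self _).symm, smul_zero, add_zero, zero_add,
    smul_smul, Complex.star_def, Complex.conj_ofReal]
  rw [← add_smul, hc, one_smul]

variable [StarOrderedRing C]

lemma IsBoundedPath.adjoint {w : ℝ≥0 → Adjointable C E F} (h : IsBoundedPath w) : IsBoundedPath fun t => (w t).adjoint :=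
  have ⟨M, hM⟩ := h.bounded
  ⟨continuous_adjoint.comp h.continuous, M, fun t => (norm_adjoint_le _).trans (hM t)⟩

/-- A norm continuous path of compact operators which tends to zero at infinity. -/
structure IsNullPath (D : ℝ≥0 → Adjointable C E F) : Prop where
  continuous : Continuous D
  mem_compacts : ∀ t, D t ∈ compacts C E F
  tendsto_zero : Tendsto D atTop (𝓝 0)

namespace IsNullPath

variable {D D' : ℝ≥0 → Adjointable C E F}

lemma zero : IsNullPath fun _ => (0 : Adjointable C E F) :=
  ⟨continuous_const, fun _ => zero_mem _, tendsto_const_nhds⟩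

lemma add (h : IsNullPath D) (h' : IsNullPath D') : IsNullPath fun t => D t + D' t :=
  ⟨h.continuous.add h'.continuous, fun t => add_mem (h.mem_compacts t) (h'.mem_compacts t),
    by simpa using h.tendsto_zero.add h'.tendsto_zero⟩

lemma sub (h : IsNullPath D) (h' : IsNullPath D') : IsNullPath fun t => D t - D' t :=
  ⟨h.continuous.sub h'.continuous, fun t => sub_mem (h.mem_compacts t) (h'.mem_compacts t),
    by simpa using h.tendsto_zero.sub h'.tendsto_zero⟩

lemma neg (h : IsNullPath D) : IsNullPath fun t => -D t := by
  simpa using zero.sub h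

lemma adjoint (h : IsNullPath D) : IsNullPath fun t => (D t).adjoint :=
  ⟨continuous_adjoint.comp h.continuous, fun t => adjoint_mem_compacts (h.mem_compacts t),
    (continuous_adjoint.tendsto' 0 0 rfl).comp h.tendsto_zero⟩

lemma bounded_comp {z : ℝ≥0 → Adjointable C F G} (hz : IsBoundedPath z) (h : IsNullPath D) :
    IsNullPath fun t => (z t).comp (D t) := by
  obtain ⟨M, hM⟩ := hz.bounded
  refine ⟨continuous_comp.comp (hz.continuous.prodMk h.continuous),
    fun t => comp_mem_compacts _ (h.mem_compacts t), ?_⟩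
  have h0 := (h.tendsto_zero.norm.const_mul M)
  rw [norm_zero, mul_zero] at h0
  exact squeeze_zero_norm (fun t => (norm_comp_le _ _).trans
    (mul_le_mul_of_nonneg_right (hM t) (norm_nonneg _))) h0

lemma comp_bounded {D : ℝ≥0 → Adjointable C F G} (h : IsNullPath D)
    {w : ℝ≥0 → Adjointable C E F} (hw : IsBoundedPath w) :
    IsNullPath fun t => (D t).comp (w t) :=
  (bounded_comp hw.adjoint h.adjoint).adjoint

end IsNullPath

/-- `w` is a bounded norm continuous path such that `t ↦ σ(a) w_t - w_t π(a)` is in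
`C₀([0, ∞), 𝓚(E, F))` for all `a`. -/
structure AsympIntertwines (π : StarRep C E A) (σ : StarRep C F A)
    (w : ℝ≥0 → Adjointable C E F) : Prop where
  isBoundedPath : IsBoundedPath w
  isNullPath : ∀ a, IsNullPath fun t => (σ a).comp (w t) - (w t).comp (π a)

namespace AsympIntertwines

variable {π : StarRep C E A} {σ : StarRep C F A} {ρ : StarRep C G A}
variable {w w' : ℝ≥0 → Adjointable C E F} {z : ℝ≥0 → Adjointable C F G}

lemma const {T : Adjointable C E F} (h : ∀ a, (σ a).comp T = T.comp (π a)) :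
    AsympIntertwines π σ fun _ => T :=
  ⟨.const T, fun a => by simpa only [h, sub_self] using IsNullPath.zero⟩

lemma add (h : AsympIntertwines π σ w) (h' : AsympIntertwines π σ w') :
    AsympIntertwines π σ fun t => w t + w' t :=
  ⟨h.isBoundedPath.add h'.isBoundedPath, fun a => by
    convert (h.isNullPath a).add (h'.isNullPath a) using 2 with t
    rw [comp_add, add_comp]; abel⟩

lemma sub (h : AsympIntertwines π σ w) (h' : AsympIntertwines π σ w') :
    AsympIntertwines π σ fun t => w t - w' t :=
  ⟨h.isBoundedPath.sub h'.isBoundedPath, fun a => by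
    convert (h.isNullPath a).sub (h'.isNullPath a) using 2 with t
    rw [comp_sub, sub_comp]; abel⟩

/-- The defect obeys a Leibniz rule: `ρ(a)zw - zwπ(a) = (ρ(a)z - zσ(a))w + z(σ(a)w - wπ(a))`. -/
lemma comp (hz : AsympIntertwines σ ρ z) (hw : AsympIntertwines π σ w) :
    AsympIntertwines π ρ fun t => (z t).comp (w t) :=
  ⟨hz.isBoundedPath.comp hw.isBoundedPath, fun a => by
    convert ((hz.isNullPath a).comp_bounded hw.isBoundedPath).add
      ((hw.isNullPath a).bounded_comp hz.isBoundedPath) using 2 with t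
    rw [sub_comp, comp_sub]
    simp only [comp_assoc]
    abel⟩

lemma adjoint (h : AsympIntertwines π σ w) : AsympIntertwines σ π fun t => (w t).adjoint :=
  ⟨h.isBoundedPath.adjoint, fun a => by
    -- The defect of `w*` at `a` is minus the adjoint of the defect of `w` at `a*`.
    convert (h.isNullPath (star a)).adjoint.neg using 2 with t
    have h1 : (σ (star a)).adjoint = σ a := by rw [map_star]; rfl
    have h2 : (π (star a)).adjoint = π a := by rw [map_star]; rfl
    rw [adjoint_sub, adjoint_comp, adjoint_comp, h1, h2]
    abel⟩

lemma asympUnitarilyEquiv (h : AsympIntertwines π σ w) (hw : ∀ t, (w t).IsUnitary) :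
    AsympUnitarilyEquiv π σ := by
  refine ⟨w, h.isBoundedPath.continuous, hw, fun a => ?_⟩
  have hD : IsNullPath fun t => conjDiff π σ (w t) a := by
    -- As `ww* = 1`, `σ(a) - wπ(a)w* = (σ(a)w - wπ(a))w*`.
    convert (h.isNullPath a).comp_bounded h.isBoundedPath.adjoint using 2 with t
    rw [sub_comp, comp_assoc, (hw t).2, comp_id]
    rfl
  refine ⟨⟨⟨fun t => ⟨_, hD.mem_compacts t⟩, hD.continuous.subtype_mk _⟩, ?_⟩, fun t => rfl⟩
  rw [cocompact_eq_atTop]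
  exact tendsto_subtype_rng.mpr hD.tendsto_zero

end AsympIntertwines

/-- The representation `π ⊕ π ⊕ ⋯`. -/
noncomputable def StarRep.ampliation (π : StarRep C E A) : StarRep C (HilbertSum C E) A where
  toFun a := HilbertSum.ampliation (π a)
  map_smul' c a := by rw [map_smul]; exact HilbertSum.ext_of_val fun _ _ => rfl
  map_zero' := by rw [map_zero]; exact HilbertSum.ext_of_val fun _ _ => rfl
  map_add' a b := by rw [map_add]; exact HilbertSum.ext_of_val fun _ _ => rfl
  map_mul' a b := by rw [map_mul]; exact HilbertSum.ext_of_val fun _ _ => rfl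
  map_star' a := by rw [map_star]; exact HilbertSum.ext_of_val fun _ _ => rfl

/-- The defect is linear in the intertwiner, so the defect of the interpolated path interpolates the
defects of the `V n`. -/
lemma exists_asympIntertwines_isometry {π : StarRep C E A} {σ : StarRep C F A}
    {V : ℕ → Adjointable C E F} (h1 : ∀ n, (V n).adjoint.comp (V n) = .id C E)
    (h0 : ∀ m n, m ≠ n → (V m).adjoint.comp (V n) = 0)
    (hK : ∀ a n, (σ a).comp (V n) - (V n).comp (π a) ∈ compacts C E F)
    (hlim : ∀ a, Tendsto (fun n => (σ a).comp (V n) - (V n).comp (π a)) atTop (𝓝 0)) :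
    ∃ v, AsympIntertwines π σ v ∧ ∀ t, (v t).adjoint.comp (v t) = .id C E := by
  refine ⟨interp V, ⟨⟨continuous_interp V, 1, fun t =>
    norm_le_one_of_adjoint_comp_self (interp_isometry h1 h0 t)⟩, fun a => ?_⟩,
    interp_isometry h1 h0⟩
  have h : ∀ t, (σ a).comp (interp V t) - (interp V t).comp (π a) =
      interp (fun n => (σ a).comp (V n) - (V n).comp (π a)) t := fun t => by
    rw [interp_comp, comp_interp, interp, interp, interp, smul_sub, smul_sub]
    abel
  simp only [h]
  exact ⟨continuous_interp _, fun t => add_mem (Submodule.smul_mem _ _ (hK a _))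
    (Submodule.smul_mem _ _ (hK a _)), tendsto_interp_zero (hlim a)⟩

end Intertwiners

/-! ### Absorbing representations -/

section Absorbing

variable {A : Type*} [NonUnitalCStarAlgebra A]
variable {C : Type v} [NonUnitalCStarAlgebra C] [PartialOrder C] [StarOrderedRing C]
variable {E : Type*} [NormedAddCommGroup E] [NormedSpace ℂ E] [SMul C E] [CStarModule C E]
variable {F : Type v} [NormedAddCommGroup F] [NormedSpace ℂ F] [SMul C F] [CStarModule C F]
  [CompleteSpace F]

/-- Restrict one unitary `φ ⊕ σ → φ` to the second summand. Compactness of the defect suffices;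
smallness is recovered later by passing far out in an infinite multiple. -/
lemma IsAbsorbing.exists_isometry {φ : StarRep C E A} (hφ : IsAbsorbing φ)
    (hF : CountablyGenerated C F) (σ : StarRep C F A) :
    ∃ V : Adjointable C F E, V.adjoint.comp V = .id C F ∧
      ∀ a, (φ a).comp V - V.comp (σ a) ∈ compacts C F E := by
  obtain ⟨u, hu, h⟩ := hφ F hF σ
  refine ⟨(u 0).comp (sumInr C E F), ?_, fun a => ?_⟩
  · rw [adjoint_comp, comp_assoc, ← comp_assoc _ (u 0), (hu 0).1, id_comp, sumInr_isometry]
  · have hK := mem_compacts_comp ((h a).2 0) ((u 0).comp (sumInr C E F))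
    rw [conjDiff, sub_comp, comp_assoc, ← comp_assoc (u 0).adjoint, (hu 0).1, id_comp,
      comp_assoc] at hK
    have h2 : (φ.directSum σ a).comp (sumInr C E F) = (sumInr C E F).comp (σ a) :=
      directSum_comp_sumInr _ _
    rwa [h2, ← comp_assoc] at hK

lemma IsAbsorbing.exists_asympIntertwines_isometry {φ : StarRep C E A} (hφ : IsAbsorbing φ)
    (hF : CountablyGenerated C F) (ψ : StarRep C F A) :
    ∃ v : ℝ≥0 → Adjointable C (HilbertSum C F) E,
      AsympIntertwines ψ.ampliation φ v ∧ ∀ t, (v t).adjoint.comp (v t) = .id C _ := by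
  -- Two ampliations: the outer one supplies infinitely many orthogonal copies to interpolate
  -- between, the inner one stays in the source of `v` to carry the shift.
  obtain ⟨V, hV, hK⟩ := hφ.exists_isometry
    (HilbertSum.countablyGenerated (HilbertSum.countablyGenerated hF)) ψ.ampliation.ampliation
  have hcomp : ∀ m n, (V.comp (HilbertSum.single C _ m)).adjoint.comp
      (V.comp (HilbertSum.single C _ n)) =
      (HilbertSum.single C (HilbertSum C F) m).adjoint.comp (HilbertSum.single C _ n) :=
    fun m n => by rw [adjoint_comp, comp_assoc, ← comp_assoc _ V, hV, id_comp]
  have hdiff : ∀ a n, (φ a).comp (V.comp (HilbertSum.single C _ n)) -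
      (V.comp (HilbertSum.single C _ n)).comp (ψ.ampliation a) =
      ((φ a).comp V - V.comp (ψ.ampliation.ampliation a)).comp (HilbertSum.single C _ n) :=
    fun a n => by
      have h : (ψ.ampliation.ampliation a).comp (HilbertSum.single C _ n) =
          (HilbertSum.single C _ n).comp (ψ.ampliation a) :=
        HilbertSum.ampliation_comp_single _ n
      rw [sub_comp, comp_assoc, comp_assoc, comp_assoc, h]
  refine HilbertModule.exists_asympIntertwines_isometry
    (V := fun n => V.comp (HilbertSum.single C _ n)) (fun n => ?_) (fun m n hmn => ?_)
    (fun a n => ?_) fun a => ?_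
  · rw [hcomp, HilbertSum.single_isometry]
  · rw [hcomp, HilbertSum.single_orthogonal hmn]
  · rw [hdiff]; exact mem_compacts_comp (hK a) _
  · simp_rw [hdiff]; exact HilbertSum.tendsto_compact_comp_single (hK a)

/-- If `φ` is absorbing, there are paths `x` and `y` of isometries which asymptotically intertwine
`φ` and `φ`, respectively `ψ` and `φ`, and whose ranges are complementary: `(x_t, y_t)` is a path
of unitaries implementing an asymptotic unitary equivalence of `φ ⊕ ψ` and `φ`. -/
lemma IsAbsorbing.exists_complementary_isometries {φ : StarRep C E A} (hφ : IsAbsorbing φ)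
    (hF : CountablyGenerated C F) (ψ : StarRep C F A) :
    ∃ (x : ℝ≥0 → Adjointable C E E) (y : ℝ≥0 → Adjointable C F E),
      AsympIntertwines φ φ x ∧ AsympIntertwines ψ φ y ∧
      (∀ t, (x t).adjoint.comp (x t) = .id C E) ∧ (∀ t, (y t).adjoint.comp (y t) = .id C F) ∧
      (∀ t, (x t).adjoint.comp (y t) = 0) ∧
      ∀ t, (x t).comp (x t).adjoint + (y t).comp (y t).adjoint = .id C E := by
  obtain ⟨v, hv, hvv⟩ := hφ.exists_asympIntertwines_isometry hF ψ
  have hS : AsympIntertwines ψ.ampliation ψ.ampliation fun _ => HilbertSum.shift C F :=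
    .const fun a => HilbertSum.ampliation_comp_shift _
  have hι : AsympIntertwines ψ ψ.ampliation fun _ => HilbertSum.single C F 0 :=
    .const fun a => HilbertSum.ampliation_comp_single _ 0
  -- `x` is the identity off the range of `v` and the transported shift on it; `y` fills the vacated
  -- first summand.
  refine ⟨fun t => .id C E - (v t).comp (v t).adjoint +
      ((v t).comp (HilbertSum.shift C F)).comp (v t).adjoint,
    fun t => (v t).comp (HilbertSum.single C F 0),
    ((AsympIntertwines.const fun _ => rfl).sub (hv.comp hv.adjoint)).add
      ((hv.comp hS).comp hv.adjoint), hv.comp hι, fun t => ?_, fun t => ?_, fun t => ?_,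
    fun t => ?_⟩
  all_goals
    have hv1 := hvv t
    beta_reduce
    generalize v t = V at hv1 ⊢
    have hv2 {X : Type v} [NormedAddCommGroup X] [NormedSpace ℂ X] [SMul C X] [CStarModule C X]
        (T : Adjointable C X (HilbertSum C F)) : V.adjoint.comp (V.comp T) = T := by
      rw [← comp_assoc, hv1, id_comp]
    have hv3 (T : Adjointable C E (HilbertSum C F)) : V.adjoint.comp (V.comp T) = T := by
      rw [← comp_assoc, hv1, id_comp]
    have hs3 (T : Adjointable C E (HilbertSum C F)) :
        (HilbertSum.shift C F).adjoint.comp ((HilbertSum.shift C F).comp T) = T := by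
      rw [← comp_assoc, HilbertSum.shift_isometry, id_comp]
    simp only [adjoint_add, adjoint_sub, adjoint_comp, adjoint_adjoint, add_comp, sub_comp,
      comp_add, comp_sub, comp_assoc, hv2, hv3, hs3, show (id C E).adjoint = id C E from rfl,
      id_comp, comp_id, HilbertSum.single_isometry, HilbertSum.shift_adjoint_comp_single_zero,
      comp_zero]
  · abel
  · abel
  -- Here `xx* + yy* = 1 - VV* + V(SS* + ι₀ι₀*)V*`, and the inner bracket is 1.
  · have h := congrArg (fun T => V.comp (T.comp V.adjoint))
      (HilbertSum.shift_single_range (C := C) (E := F))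
    simp only [add_comp, comp_add, comp_assoc, id_comp] at h
    rw [← sub_eq_zero] at h ⊢
    rw [← h]
    abel

end Absorbing

/-- Two absorbing representations on a countably generated Hilbert module are asymptotically
unitarily equivalent. -/
theorem IsAbsorbing.asympUnitarilyEquiv {A : Type*} [NonUnitalCStarAlgebra A]
    {C : Type v} [NonUnitalCStarAlgebra C] [PartialOrder C] [StarOrderedRing C]
    {E : Type v} [NormedAddCommGroup E] [NormedSpace ℂ E] [SMul C E] [CStarModule C E]
    [CompleteSpace E] {F : Type v} [NormedAddCommGroup F] [NormedSpace ℂ F] [SMul C F]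
    [CStarModule C F] [CompleteSpace F] (hE : CountablyGenerated C E)
    (hF : CountablyGenerated C F) {φ : StarRep C E A} {ψ : StarRep C F A}
    (hφ : IsAbsorbing φ) (hψ : IsAbsorbing ψ) : AsympUnitarilyEquiv φ ψ := by
  obtain ⟨x, y, hx, hy, hxx, hyy, hxy, hsum⟩ := hφ.exists_complementary_isometries hF ψ
  obtain ⟨x', y', hx', hy', hxx', hyy', hxy', hsum'⟩ := hψ.exists_complementary_isometries hE φ
  -- The unitary `U = y'x* + x'y*` is `(x, y)*`, then the flip, then `(x', y')`. Orthogonality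
  -- leaves `U*U = xx* + yy*` and `UU* = x'x'* + y'y'*`.
  refine ((hy'.comp hx.adjoint).add (hx'.comp hy.adjoint)).asympUnitarilyEquiv fun t => ?_
  have h := congrArg Adjointable.adjoint (hxy t)
  have h' := congrArg Adjointable.adjoint (hxy' t)
  rw [adjoint_comp, adjoint_adjoint, show (0 : Adjointable C _ _).adjoint = 0 from rfl] at h h'
  constructor
  · simp only [adjoint_add, adjoint_comp, adjoint_adjoint, add_comp, comp_add]
    rw [comp_assoc, comp_assoc, comp_assoc, comp_assoc, ← comp_assoc (y' t).adjoint,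
      ← comp_assoc (y' t).adjoint, ← comp_assoc (x' t).adjoint, ← comp_assoc (x' t).adjoint,
      hyy', hxx', hxy', h', zero_comp, zero_comp, comp_zero, comp_zero, id_comp, id_comp,
      add_zero, zero_add, hsum]
  · simp only [adjoint_add, adjoint_comp, adjoint_adjoint, add_comp, comp_add]
    rw [comp_assoc, comp_assoc, comp_assoc, comp_assoc, ← comp_assoc (x t).adjoint,
      ← comp_assoc (x t).adjoint, ← comp_assoc (y t).adjoint, ← comp_assoc (y t).adjoint,
      hyy, hxx, hxy, h, zero_comp, zero_comp, comp_zero, comp_zero, id_comp, id_comp,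
      add_zero, zero_add, add_comm, hsum']

end HilbertModule

theorem theorem2p6 {A : Type*} [NonUnitalCStarAlgebra A] [TopologicalSpace.SeparableSpace A]
    {B : Type*} [NonUnitalCStarAlgebra B] [PartialOrder B] [StarOrderedRing B]
    [TopologicalSpace.SeparableSpace B]
    (ψ φ : HilbertModule.StarRep Bᵐᵒᵖ (HilbertModule.StandardModule B) A)
    (hψ : HilbertModule.IsAbsorbing ψ) (hφ : HilbertModule.IsAbsorbing φ) :
    HilbertModule.AsympUnitarilyEquiv φ ψ := by
  have : TopologicalSpace.SeparableSpace Bᵐᵒᵖ :=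
    (MulOpposite.opHomeomorph (M := B)).surjective.denseRange.separableSpace
      MulOpposite.continuous_op
  -- Separability of `B` enters here: each absorbing representation must be able to absorb multiples
  -- of the other.
  have h : HilbertModule.CountablyGenerated Bᵐᵒᵖ (HilbertModule.StandardModule B) :=
    HilbertModule.HilbertSum.countablyGenerated HilbertModule.countablyGenerated_self
  exact hφ.asympUnitarilyEquiv h h hψ
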